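/- Theorem 3.2. Let $X_1$ and $X_2$ be independent real random variables and let $Z_1$ be a directed triangular random variable between them, that is, a random variable such that, for almost every value $(x_1,x_2)$ of $(X_1,X_2)$, the conditional distribution function of $Z_1$ given $X_1=x_1$, $X_2=x_2$ is $$F_{Z_1\mid x_1,x_2}(z)=\begin{cases}1, & z\ge \max(x_1,x_2),\\ \left(\frac{z-x_1}{x_2-x_1}\right)^2, & x_1<z<x_2,\\ 1-\left(\frac{z-x_1}{x_2-x_1}\right)^2, & x_2<z<x_1,\\ 0, & z\le\min(x_1,x_2)\ \text{and}\ z<\max(x_1,x_2).\end{cases}$$ Then: (a) if $X_2$ is uniformly distributed on $[-1,1]$, then $Z_1$ has the semicircle distribution on $[-1,1]$ (density $\frac{2}{\pi}\sqrt{1-z^2}$, $-1\le z\le 1$) if and only if $X_1$ has the arcsine distribution on $[-1,1]$ (density $\frac{1}{\pi\sqrt{1-x^2}}$, $-1<x<1$); (b) if $X_2$ is uniformly distributed on $[-1,1]$, then $Z_1$ has the power semicircle distribution, with density $\frac{3(1-z^2)}{4}$, $-1\le z\le 1$, if and only if $X_1$ has this distribution; (c) if $X_2$ has the Beta$(1,1)$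 distribution on $[0,1]$, then $Z_1$ has the Beta$(\frac32,\frac32)$ distribution if and only if $X_1$ has the Beta$(\frac12,\frac12)$ distribution; (d) if $X_2$ is uniformly distributed on $[0,1]$, then $Z_1$ has the Beta$(2,2)$ distribution if and only if $X_1$ has the Beta$(2,2)$ distribution. -/

import Mathlib

open MeasureTheory ProbabilityTheory

noncomputable section

/-- The conditionally directed power distribution function with parameter `n`: the conditional
distribution function, at `z`, of a random variable `Z₁` given `X₁ = x₁` and `X₂ = x₂`.
On the diagonal `x₁ = x₂` it is the distribution function of the point mass at `x₁`. -/
def directedPowerCDF (n : ℕ) (x₁ x₂ z : ℝ) : ℝ :=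
  if max x₁ x₂ ≤ z then 1
  else if z ≤ min x₁ x₂ then 0
  else if x₁ < x₂ then ((z - x₁) / (x₂ - x₁)) ^ n
  else 1 - ((z - x₁) / (x₂ - x₁)) ^ n

/-- `Z₁` has a conditionally directed power distribution with parameter `n` between `X₁` and `X₂`:
for almost every value `(x₁, x₂)` of `(X₁, X₂)`, the conditional distribution function of `Z₁`
given `X₁ = x₁, X₂ = x₂` is `directedPowerCDF n x₁ x₂`. -/
def IsDirectedPower {Ω : Type*} [MeasurableSpace Ω] (P : Measure Ω) [IsFiniteMeasure P]
    (n : ℕ) (X₁ X₂ Z₁ : Ω → ℝ) : Prop :=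
  ∀ᵐ x ∂(P.map fun ω => (X₁ ω, X₂ ω)), ∀ z : ℝ,
    cdf (condDistrib Z₁ (fun ω => (X₁ ω, X₂ ω)) P x) z = directedPowerCDF n x.1 x.2 z

/-- `Z₁` is a directed triangular random variable between `X₁` and `X₂`. -/
def IsDirectedTriangular {Ω : Type*} [MeasurableSpace Ω] (P : Measure Ω) [IsFiniteMeasure P]
    (X₁ X₂ Z₁ : Ω → ℝ) : Prop :=
  IsDirectedPower P 2 X₁ X₂ Z₁

/-- The arcsine distribution on `[-1, 1]`. -/
def arcsineMeasure : Measure ℝ :=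
  (volume.restrict (Set.Ioo (-1) 1)).withDensity
    fun x => ENNReal.ofReal (1 / (Real.pi * √(1 - x ^ 2)))

/-- The (Wigner) semicircle distribution on `[-1, 1]`. -/
def semicircleMeasure : Measure ℝ :=
  (volume.restrict (Set.Icc (-1) 1)).withDensity
    fun x => ENNReal.ofReal (2 / Real.pi * √(1 - x ^ 2))

/-- The power semicircle distribution on `[-1, 1]` with density `3 (1 - x ^ 2) / 4`. -/
def powerSemicircleMeasure : Measure ℝ :=
  (volume.restrict (Set.Icc (-1) 1)).withDensity
    fun x => ENNReal.ofReal (3 * (1 - x ^ 2) / 4)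

end

/-!
Given `X₁ = x` and `X₂ = y`, a directed triangular variable is distributed as `x + W (y - x)` with
`W` of density `2 w` on `[0, 1]`. When `X₂` is uniform on `[a, b]`, the conditional expectation of
`f Z₁` given `X₁ = x` is therefore the double integral `directedAverage a b f x`. Integrating
`f = F''` over `y` and then over `w` shows that it is a second divided difference of `F`, so that for
`F a = F b = 0`
`E (F'' Z₁) = -2 E (F X₁ / ((X₁ - a) (b - X₁)))`
(`directedAverage_eq_div`, `integral_map_of_isDirectedTriangular`).

If `p` and `q` are densities on `(a, b)` with `q'' = -2 p / ((x - a) (b - x))` and `q` vanishes at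
the endpoints, two integrations by parts give the same relation between the measures with densities
`q` and `p` (`integral_mul_deriv_deriv`). Hence `X₁ ~ p` implies `Z₁ ~ q`, since every bounded
continuous function is some `F''` with `F a = F b = 0`. Conversely, taking
`F x = (x - a) (b - x) g x` with `g` smooth and compactly supported, the relation reads
`E (F'' Z₁) = -2 E (g X₁)`, so the law of `Z₁` determines that of `X₁`; no bound on the support of
`X₁` has to be known beforehand. Both directions are `IsDirectedPair.eq_densityMeasure_iff`.

The four equivalences are the pairs with `q` proportional to `√((x - a) (b - x))` and `p`
proportional to its inverse (`isDirectedPair_sqrt`), and with `p = q` proportional to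
`(x - a) (b - x)` (`isDirectedPair_parabola`).
-/

open Set Filter Topology

/-! ### Averages over a segment with uniform endpoint -/

/-- The average of `f (x + w * (y - x))` when `y` is uniform on `[a, b]` and `w` has density `2 * w`
on `[0, 1]`: the conditional expectation of `f Z` given `X₁ = x`, for `Z` directed triangular
between `X₁` and a uniform variable on `[a, b]`. -/
noncomputable def directedAverage (a b : ℝ) (f : ℝ → ℝ) (x : ℝ) : ℝ :=
  (b - a)⁻¹ * ∫ y in a..b, ∫ w in (0 : ℝ)..1, 2 * w * f (x + w * (y - x))

theorem abs_directedAverage_le {a b M : ℝ} (hab : a < b) {f : ℝ → ℝ} (hM : ∀ x, |f x| ≤ M)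
    (x : ℝ) : |directedAverage a b f x| ≤ 2 * M := by
  have hba : 0 < b - a := sub_pos.2 hab
  have hinner (y : ℝ) : ‖∫ w in (0 : ℝ)..1, 2 * w * f (x + w * (y - x))‖ ≤ 2 * M := by
    have := intervalIntegral.norm_integral_le_of_norm_le_const (a := (0 : ℝ)) (b := 1) (C := 2 * M)
      (f := fun w => 2 * w * f (x + w * (y - x))) (fun w hw => by
        rw [uIoc_of_le zero_le_one] at hw
        rw [Real.norm_eq_abs, abs_mul, abs_of_pos (by linarith [hw.1] : (0 : ℝ) < 2 * w)]
        have := hM (x + w * (y - x))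
        have h0 := abs_nonneg (f (x + w * (y - x)))
        nlinarith [hw.1, hw.2])
    simpa using this
  have houter := intervalIntegral.norm_integral_le_of_norm_le_const (a := a) (b := b)
    (C := 2 * M) (f := fun y => ∫ w in (0 : ℝ)..1, 2 * w * f (x + w * (y - x)))
    (fun y _ => hinner y)
  rw [Real.norm_eq_abs, abs_of_pos hba] at houter
  rw [directedAverage, abs_mul, abs_of_pos (inv_pos.2 hba), inv_mul_le_iff₀ hba]
  linarith

/-- Integrating in `y` first turns the average of `F''` into a difference of two averages of `F'`
along the segments from `x` to the endpoints. -/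
theorem directedAverage_eq_sub {a b : ℝ} {F' f : ℝ → ℝ}
    (hF' : ∀ x, HasDerivAt F' (f x) x) (hf : Continuous f) (x : ℝ) :
    directedAverage a b f x = (b - a)⁻¹ * (2 * ((∫ w in (0 : ℝ)..1, F' (x + w * (b - x))) -
      ∫ w in (0 : ℝ)..1, F' (x + w * (a - x)))) := by
  have hF'c : Continuous F' := continuous_iff_continuousAt.2 fun x => (hF' x).continuousAt
  have hswap : (∫ y in a..b, ∫ w in (0 : ℝ)..1, 2 * w * f (x + w * (y - x))) =
      ∫ w in (0 : ℝ)..1, ∫ y in a..b, 2 * w * f (x + w * (y - x)) := by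
    refine intervalIntegral_intervalIntegral_swap ?_
    refine IntegrableOn.mono_set (t := uIcc a b ×ˢ uIcc 0 1) ?_
      (prod_mono uIoc_subset_uIcc uIoc_subset_uIcc)
    refine ContinuousOn.integrableOn_compact (isCompact_uIcc.prod isCompact_uIcc) ?_
    exact Continuous.continuousOn (by simp only [Function.uncurry_def]; fun_prop)
  have hinner (w : ℝ) : ∫ y in a..b, 2 * w * f (x + w * (y - x)) =
      2 * (F' (x + w * (b - x)) - F' (x + w * (a - x))) := by
    have h (y : ℝ) : HasDerivAt (fun y => 2 * F' (x + w * (y - x)))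
        (2 * w * f (x + w * (y - x))) y := by
      have h1 : HasDerivAt (fun y : ℝ => x + w * (y - x)) w y := by
        simpa using (((hasDerivAt_id y).sub_const x).const_mul w).const_add x
      exact (((hF' _).comp y h1).const_mul 2).congr_deriv (by ring)
    rw [intervalIntegral.integral_eq_sub_of_hasDerivAt (fun y _ => h y)
      (Continuous.intervalIntegrable (by fun_prop) _ _)]
    ring
  rw [directedAverage, hswap]
  simp_rw [hinner]
  rw [intervalIntegral.integral_const_mul, intervalIntegral.integral_sub
    (Continuous.intervalIntegrable (by fun_prop) _ _)
    (Continuous.intervalIntegrable (by fun_prop) _ _)]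

/-- The average of `F'` along a segment is the difference quotient of `F`. -/
theorem sub_mul_integral_segment {F F' : ℝ → ℝ} (hF : ∀ x, HasDerivAt F (F' x) x)
    (hF' : Continuous F') (x b : ℝ) :
    (b - x) * ∫ w in (0 : ℝ)..1, F' (x + w * (b - x)) = F b - F x := by
  rw [← intervalIntegral.integral_const_mul]
  have h (w : ℝ) : HasDerivAt (fun w => F (x + w * (b - x))) ((b - x) * F' (x + w * (b - x))) w := by
    have h1 : HasDerivAt (fun w : ℝ => x + w * (b - x)) (b - x) w := by
      simpa using ((hasDerivAt_id w).mul_const (b - x)).const_add x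
    exact ((hF _).comp w h1).congr_deriv (by ring)
  rw [intervalIntegral.integral_eq_sub_of_hasDerivAt (fun w _ => h w)
    (Continuous.intervalIntegrable (by fun_prop) _ _)]
  simp

/-- Away from the endpoints, the average of `F''` is a second divided difference of `F`. -/
theorem directedAverage_eq_div {a b : ℝ} (hab : a < b) {F F' f : ℝ → ℝ}
    (hF : ∀ x, HasDerivAt F (F' x) x) (hF' : ∀ x, HasDerivAt F' (f x) x) (hf : Continuous f)
    (hFa : F a = 0) (hFb : F b = 0) {x : ℝ} (hxa : x ≠ a) (hxb : x ≠ b) :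
    directedAverage a b f x = -2 * (F x / ((x - a) * (b - x))) := by
  have hF'c : Continuous F' := continuous_iff_continuousAt.2 fun x => (hF' x).continuousAt
  have h1 := sub_mul_integral_segment hF hF'c x b
  have h2 := sub_mul_integral_segment hF hF'c x a
  rw [directedAverage_eq_sub hF' hf]
  have hba : b - a ≠ 0 := (sub_pos.2 hab).ne'
  have hxa' : x - a ≠ 0 := sub_ne_zero.2 hxa
  have hax' : a - x ≠ 0 := sub_ne_zero.2 hxa.symm
  have hbx' : b - x ≠ 0 := sub_ne_zero.2 hxb.symm
  rw [mul_comm, ← eq_div_iff hbx'] at h1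
  rw [mul_comm, ← eq_div_iff hax'] at h2
  rw [h1, h2, hFa, hFb]
  field_simp
  ring

/-- The average of the second derivative of `(x - a) * (b - x) * h x` is `-2 * h x`, at the
endpoints as well. -/
theorem directedAverage_eq_of_mul {a b : ℝ} (hab : a < b) {h F' f : ℝ → ℝ}
    (hF : ∀ x, HasDerivAt (fun x => (x - a) * (b - x) * h x) (F' x) x)
    (hF' : ∀ x, HasDerivAt F' (f x) x) (hf : Continuous f)
    (hFa : F' a = (b - a) * h a) (hFb : F' b = -((b - a) * h b)) (x : ℝ) :
    directedAverage a b f x = -2 * h x := by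
  have hF'c : Continuous F' := continuous_iff_continuousAt.2 fun x => (hF' x).continuousAt
  have hba : b - a ≠ 0 := (sub_pos.2 hab).ne'
  have h1 : ∫ w in (0 : ℝ)..1, F' (x + w * (b - x)) = -((x - a) * h x) := by
    by_cases hx : x = b
    · subst hx; simp [hFb]
    · refine mul_left_cancel₀ (sub_ne_zero.2 (Ne.symm hx)) ?_
      rw [sub_mul_integral_segment hF hF'c x b]; ring
  have h2 : ∫ w in (0 : ℝ)..1, F' (x + w * (a - x)) = (b - x) * h x := by
    by_cases hx : x = a
    · subst hx; simp [hFa]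
    · refine mul_left_cancel₀ (sub_ne_zero.2 (Ne.symm hx)) ?_
      rw [sub_mul_integral_segment hF hF'c x a]; ring
  rw [directedAverage_eq_sub hF' hf, h1, h2]
  field_simp
  ring

/-! ### Integration by parts and test functions -/

/-- The divided difference of `F` is half an average of `F''`, hence bounded by `sup |F''|`. -/
theorem abs_div_le_of_hasDerivAt {a b M : ℝ} (hab : a < b) {F F' f : ℝ → ℝ}
    (hF : ∀ x, HasDerivAt F (F' x) x) (hF' : ∀ x, HasDerivAt F' (f x) x) (hf : Continuous f)
    (hFa : F a = 0) (hFb : F b = 0) (hM : ∀ x, |f x| ≤ M) (x : ℝ) :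
    |F x / ((x - a) * (b - x))| ≤ M := by
  by_cases hxa : x = a
  · simpa [hxa] using (abs_nonneg _).trans (hM a)
  by_cases hxb : x = b
  · simpa [hxb] using (abs_nonneg _).trans (hM a)
  have h := abs_directedAverage_le hab hM x
  rw [directedAverage_eq_div hab hF hF' hf hFa hFb hxa hxb, abs_mul] at h
  norm_num at h
  exact h

/-- Integration by parts twice against a density `q` on `[a, b]` vanishing at the endpoints, when
`q'' = -2 p / ((x - a) (b - x))`. The derivative `r = q'` may be unbounded at the endpoints. -/
theorem integral_mul_deriv_deriv {a b M : ℝ} (hab : a < b) {F F' f p q r : ℝ → ℝ}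
    (hF : ∀ x, HasDerivAt F (F' x) x) (hF' : ∀ x, HasDerivAt F' (f x) x) (hf : Continuous f)
    (hFa : F a = 0) (hFb : F b = 0) (hM : ∀ x, |f x| ≤ M)
    (hqc : ContinuousOn q (Icc a b)) (hqa : q a = 0) (hqb : q b = 0)
    (hq : ∀ x ∈ Ioo a b, HasDerivAt q (r x) x)
    (hr : ∀ x ∈ Ioo a b, HasDerivAt r (-2 * p x / ((x - a) * (b - x))) x)
    (hsr : ContinuousOn (fun x => (x - a) * (b - x) * r x) (Icc a b))
    (hp : IntegrableOn p (Ioo a b)) :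
    ∫ x in Ioo a b, q x * f x = ∫ x in Ioo a b, p x * (-2 * (F x / ((x - a) * (b - x)))) := by
  have hFc : Continuous F := continuous_iff_continuousAt.2 fun x => (hF x).continuousAt
  have hF'c : Continuous F' := continuous_iff_continuousAt.2 fun x => (hF' x).continuousAt
  have hle (x : ℝ) (hx : x ∈ Icc a b) : ‖F x * r x‖ ≤ M * |(x - a) * (b - x) * r x| := by
    have hM0 : 0 ≤ M := (abs_nonneg _).trans (hM a)
    rcases eq_or_lt_of_le hx.1 with rfl | hxa
    · simp [hFa]
    rcases eq_or_lt_of_le hx.2 with rfl | hxb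
    · simp [hFb]
    have hs : (x - a) * (b - x) ≠ 0 := (mul_pos (sub_pos.2 hxa) (sub_pos.2 hxb)).ne'
    have h := abs_div_le_of_hasDerivAt hab hF hF' hf hFa hFb hM x
    calc ‖F x * r x‖ = |F x / ((x - a) * (b - x))| * |(x - a) * (b - x) * r x| := by
          rw [Real.norm_eq_abs, ← abs_mul]; congr 1; field_simp
      _ ≤ _ := by gcongr
  -- `F * r` vanishes at an endpoint `c`: it is the product of the bounded function
  -- `F / ((x - a) (b - x))` and of `(x - a) (b - x) r`, which is continuous and zero at `c`.
  have hend (c : ℝ) (hc : c ∈ Icc a b) (hFz : F c = 0) (hsc : (c - a) * (b - c) = 0) :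
      ContinuousWithinAt (fun x => F x * r x) (Icc a b) c := by
    have h1 := ((hsr c hc).abs.const_mul M)
    simp only [ContinuousWithinAt, hsc, zero_mul, abs_zero, mul_zero] at h1
    simp only [ContinuousWithinAt, hFz, zero_mul]
    exact squeeze_zero_norm' (eventually_mem_nhdsWithin.mono hle) h1
  have hFr : ContinuousOn (fun x => F x * r x) (Icc a b) := by
    intro x hx
    rcases eq_or_lt_of_le hx.1 with rfl | hxa
    · exact hend _ hx hFa (by ring)
    rcases eq_or_lt_of_le hx.2 with rfl | hxb
    · exact hend _ hx hFb (by ring)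
    exact (hFc.continuousAt.mul (hr x ⟨hxa, hxb⟩).continuousAt).continuousWithinAt
  have hderiv (x : ℝ) (hx : x ∈ Ioo a b) : HasDerivAt (fun x => F' x * q x - F x * r x)
      (q x * f x - p x * (-2 * (F x / ((x - a) * (b - x))))) x := by
    exact (((hF' x).mul (hq x hx)).sub ((hF x).mul (hr x hx))).congr_deriv (by ring)
  have hi1 : IntegrableOn (fun x => q x * f x) (Ioo a b) :=
    ((hqc.mul hf.continuousOn).integrableOn_Icc).mono_set Ioo_subset_Icc_self
  have hi2 : IntegrableOn (fun x => p x * (-2 * (F x / ((x - a) * (b - x))))) (Ioo a b) := by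
    refine Integrable.mul_bdd (c := 2 * M) hp
      (by have := hFc.measurable; exact Measurable.aestronglyMeasurable (by fun_prop))
      (ae_of_all _ fun x => ?_)
    have h := abs_div_le_of_hasDerivAt hab hF hF' hf hFa hFb hM x
    rw [norm_mul, Real.norm_eq_abs, Real.norm_eq_abs]
    norm_num
    linarith
  have hftc := intervalIntegral.integral_eq_sub_of_hasDerivAt_of_le hab.le
    ((hF'c.continuousOn.mul hqc).sub hFr) hderiv
    ((intervalIntegrable_iff_integrableOn_Ioo_of_le hab.le).2 (hi1.sub hi2))
  rw [intervalIntegral.integral_of_le hab.le, integral_Ioc_eq_integral_Ioo,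
    integral_sub hi1 hi2] at hftc
  simp only [Pi.sub_apply, Pi.mul_apply, hqa, hqb, hFa, hFb] at hftc
  linarith

/-- Every continuous function is the second derivative of a function vanishing at `a` and `b`. -/
theorem exists_hasDerivAt_hasDerivAt {a b : ℝ} (hab : a < b) {f : ℝ → ℝ} (hf : Continuous f) :
    ∃ F F' : ℝ → ℝ, (∀ x, HasDerivAt F (F' x) x) ∧ (∀ x, HasDerivAt F' (f x) x) ∧
      F a = 0 ∧ F b = 0 := by
  have h1 (x : ℝ) : HasDerivAt (fun x => ∫ t in a..x, f t) (f x) x :=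
    (hf.integral_hasStrictDerivAt a x).hasDerivAt
  have hc : Continuous fun x => ∫ t in a..x, f t :=
    continuous_iff_continuousAt.2 fun x => (h1 x).continuousAt
  set g := fun x => ∫ t in a..x, f t
  have h2 (x : ℝ) : HasDerivAt (fun x => ∫ t in a..x, g t) (g x) x :=
    (hc.integral_hasStrictDerivAt a x).hasDerivAt
  set k := (∫ t in a..b, g t) / (b - a)
  refine ⟨fun x => (∫ t in a..x, g t) - (x - a) * k, fun x => g x - k, fun x => ?_,
    fun x => (h1 x).sub_const k, by simp, ?_⟩
  · exact ((h2 x).sub (((hasDerivAt_id x).sub_const a).mul_const k)).congr_deriv (by ring)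
  · have : b - a ≠ 0 := (sub_pos.2 hab).ne'
    simp only [k]
    field_simp
    ring

/-- A finite measure on `ℝ` is determined by its integrals of smooth compactly supported
functions. -/
theorem ext_of_integral_contDiff {μ ν : Measure ℝ} [IsFiniteMeasure μ] [IsFiniteMeasure ν]
    (h : ∀ g : ℝ → ℝ, ContDiff ℝ 2 g → HasCompactSupport g → ∫ x, g x ∂μ = ∫ x, g x ∂ν) :
    μ = ν := by
  refine Real.measure_ext_Ioo_rat fun p q => ?_
  -- Smooth approximations from below of the indicator of `Ioo p q`.
  let g : ℕ → ℝ → ℝ := fun n x =>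
    Real.smoothTransition (n * (x - p)) * Real.smoothTransition (n * (q - x))
  have hg (n : ℕ) : ContDiff ℝ 2 (g n) :=
    (Real.smoothTransition.contDiff.comp (by fun_prop)).mul
      (Real.smoothTransition.contDiff.comp (by fun_prop))
  have hsupp (n : ℕ) (x : ℝ) (hx : x ∉ Ioo (p : ℝ) q) : g n x = 0 := by
    rw [mem_Ioo, not_and_or, not_lt, not_lt] at hx
    rcases hx with hx | hx
    · simp only [g]
      rw [Real.smoothTransition.zero_of_nonpos
        (mul_nonpos_of_nonneg_of_nonpos n.cast_nonneg (sub_nonpos.2 hx)), zero_mul]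
    · simp only [g]
      rw [Real.smoothTransition.zero_of_nonpos
        (mul_nonpos_of_nonneg_of_nonpos n.cast_nonneg (sub_nonpos.2 hx)), mul_zero]
  have hcomp (n : ℕ) : HasCompactSupport (g n) :=
    HasCompactSupport.intro (isCompact_Icc (a := (p : ℝ)) (b := q)) fun x hx =>
      hsupp n x fun hx' => hx (Ioo_subset_Icc_self hx')
  have hlim (x : ℝ) : Tendsto (fun n => g n x) atTop
      (𝓝 ((Ioo (p : ℝ) q).indicator (fun _ => (1 : ℝ)) x)) := by
    by_cases hx : x ∈ Ioo (p : ℝ) q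
    · rw [indicator_of_mem hx]
      refine tendsto_const_nhds.congr' ?_
      have e1 : ∀ᶠ n : ℕ in atTop, (1 : ℝ) ≤ n * (x - p) :=
        (tendsto_natCast_atTop_atTop.atTop_mul_const (sub_pos.2 hx.1)).eventually_ge_atTop 1
      have e2 : ∀ᶠ n : ℕ in atTop, (1 : ℝ) ≤ n * (q - x) :=
        (tendsto_natCast_atTop_atTop.atTop_mul_const (sub_pos.2 hx.2)).eventually_ge_atTop 1
      filter_upwards [e1, e2] with n h1 h2
      simp [g, Real.smoothTransition.one_of_one_le h1, Real.smoothTransition.one_of_one_le h2]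
    · rw [indicator_of_notMem hx]
      simp [hsupp _ x hx]
  have hbound (n : ℕ) (x : ℝ) : ‖g n x‖ ≤ 1 := by
    rw [Real.norm_eq_abs, abs_of_nonneg (mul_nonneg (Real.smoothTransition.nonneg _)
      (Real.smoothTransition.nonneg _))]
    exact mul_le_one₀ (Real.smoothTransition.le_one _) (Real.smoothTransition.nonneg _)
      (Real.smoothTransition.le_one _)
  have key (m : Measure ℝ) [IsFiniteMeasure m] :
      Tendsto (fun n => ∫ x, g n x ∂m) atTop (𝓝 (m.real (Ioo p q))) := by
    rw [← integral_indicator_one measurableSet_Ioo]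
    exact tendsto_integral_of_dominated_convergence (fun _ => 1)
      (fun n => (hg n).continuous.aestronglyMeasurable) (integrable_const _)
      (fun n => ae_of_all _ (hbound n)) (ae_of_all _ hlim)
  have heq : μ.real (Ioo p q) = ν.real (Ioo p q) := by
    refine tendsto_nhds_unique (key μ) ((key ν).congr fun n => ?_)
    exact (h _ (hg n) (hcomp n)).symm
  exact (measureReal_eq_measureReal_iff).1 heq

/-! ### Pairs of densities -/

/-- The measure on `(a, b)` with density `q`. -/
noncomputable def densityMeasure (a b : ℝ) (q : ℝ → ℝ) : Measure ℝ :=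
  (volume.restrict (Ioo a b)).withDensity fun x => ENNReal.ofReal (q x)

theorem densityMeasure_congr {a b : ℝ} {p q : ℝ → ℝ} (h : ∀ x ∈ Ioo a b, p x = q x) :
    densityMeasure a b p = densityMeasure a b q :=
  withDensity_congr_ae <| (ae_restrict_iff' measurableSet_Ioo).2 <|
    ae_of_all _ fun x hx => by simp only [h x hx]

theorem isFiniteMeasure_densityMeasure {a b : ℝ} {q : ℝ → ℝ} (hq : IntegrableOn q (Ioo a b)) :
    IsFiniteMeasure (densityMeasure a b q) :=
  isFiniteMeasure_withDensity_ofReal hq.2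

theorem integral_densityMeasure {a b : ℝ} {q : ℝ → ℝ} (hq : IntegrableOn q (Ioo a b))
    (hq0 : ∀ x ∈ Ioo a b, 0 ≤ q x) (g : ℝ → ℝ) :
    ∫ x, g x ∂densityMeasure a b q = ∫ x in Ioo a b, q x * g x := by
  rw [densityMeasure, integral_withDensity_eq_integral_toReal_smul₀
    hq.1.aemeasurable.ennreal_ofReal (ae_of_all _ fun _ => ENNReal.ofReal_lt_top)]
  refine setIntegral_congr_fun measurableSet_Ioo fun x hx => ?_
  simp [ENNReal.toReal_ofReal (hq0 x hx)]

/-- Densities `p` and `q` on `(a, b)` tied by `q'' = -2 p / ((x - a) (b - x))`, with `q` vanishing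
at the endpoints. The last condition of `exists_deriv` says that `(x - a) (b - x) q'` tends to `0`
there, whatever the junk value of `q'` at the endpoints. -/
structure IsDirectedPair (a b : ℝ) (p q : ℝ → ℝ) : Prop where
  lt : a < b
  nonneg_left : ∀ x ∈ Ioo a b, 0 ≤ p x
  nonneg_right : ∀ x ∈ Ioo a b, 0 ≤ q x
  integrableOn : IntegrableOn p (Ioo a b)
  continuousOn : ContinuousOn q (Icc a b)
  apply_left : q a = 0
  apply_right : q b = 0
  exists_deriv : ∃ r : ℝ → ℝ, (∀ x ∈ Ioo a b, HasDerivAt q (r x) x) ∧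
    (∀ x ∈ Ioo a b, HasDerivAt r (-2 * p x / ((x - a) * (b - x))) x) ∧
    ContinuousOn (fun x => (x - a) * (b - x) * r x) (Icc a b)

namespace IsDirectedPair

variable {a b : ℝ} {p q : ℝ → ℝ}

theorem integrableOn_right (h : IsDirectedPair a b p q) : IntegrableOn q (Ioo a b) :=
  h.continuousOn.integrableOn_Icc.mono_set Ioo_subset_Icc_self

theorem integral_deriv_deriv (h : IsDirectedPair a b p q) {F F' f : ℝ → ℝ} {M : ℝ}
    (hF : ∀ x, HasDerivAt F (F' x) x) (hF' : ∀ x, HasDerivAt F' (f x) x) (hf : Continuous f)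
    (hFa : F a = 0) (hFb : F b = 0) (hM : ∀ x, |f x| ≤ M) :
    ∫ x, f x ∂densityMeasure a b q =
      ∫ x, -2 * (F x / ((x - a) * (b - x))) ∂densityMeasure a b p := by
  obtain ⟨r, hr, hr', hsr⟩ := h.exists_deriv
  rw [integral_densityMeasure h.integrableOn_right h.nonneg_right,
    integral_densityMeasure h.integrableOn h.nonneg_left]
  exact integral_mul_deriv_deriv h.lt hF hF' hf hFa hFb hM h.continuousOn h.apply_left
    h.apply_right hr hr' hsr h.integrableOn

/-- If `ρ` is obtained from `μ` by `directedAverage`, then `ρ` has density `q` exactly when `μ` has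
density `p`. -/
theorem eq_densityMeasure_iff (h : IsDirectedPair a b p q) {μ ρ : Measure ℝ} [IsFiniteMeasure μ]
    [IsFiniteMeasure ρ] (hμρ : ∀ f : ℝ → ℝ, Continuous f → ∀ M : ℝ, (∀ x, |f x| ≤ M) →
      ∫ x, f x ∂ρ = ∫ x, directedAverage a b f x ∂μ) :
    ρ = densityMeasure a b q ↔ μ = densityMeasure a b p := by
  have := isFiniteMeasure_densityMeasure h.integrableOn
  have := isFiniteMeasure_densityMeasure h.integrableOn_right
  constructor
  · rintro rfl
    refine ext_of_integral_contDiff fun g hg hgc => ?_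
    -- Test against `f = F''` with `F x = (x - a) * (b - x) * g x`.
    have hg1 : ContDiff ℝ 1 (deriv g) := ContDiff.deriv' hg
    have hg2 : Continuous (deriv (deriv g)) := hg1.continuous_deriv le_rfl
    have hd (x : ℝ) : HasDerivAt g (deriv g x) x :=
      (hg.differentiable two_ne_zero x).hasDerivAt
    have hd' (x : ℝ) : HasDerivAt (deriv g) (deriv (deriv g) x) x :=
      (hg1.differentiable one_ne_zero x).hasDerivAt
    have hs (x : ℝ) : HasDerivAt (fun x => (x - a) * (b - x)) (a + b - 2 * x) x :=
      (((hasDerivAt_id x).sub_const a).mul ((hasDerivAt_id x).const_sub b)).congr_deriv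
        (by simp; ring)
    have hs' (x : ℝ) : HasDerivAt (fun x => a + b - 2 * x) (-2) x :=
      (((hasDerivAt_id x).const_mul 2).const_sub (a + b)).congr_deriv (by ring)
    set F' : ℝ → ℝ := fun x => (a + b - 2 * x) * g x + (x - a) * (b - x) * deriv g x with hF'def
    set f : ℝ → ℝ := fun x => -2 * g x + 2 * (a + b - 2 * x) * deriv g x +
      (x - a) * (b - x) * deriv (deriv g) x with hfdef
    have hF (x : ℝ) : HasDerivAt (fun x => (x - a) * (b - x) * g x) (F' x) x :=
      (hs x).mul (hd x)
    have hF' (x : ℝ) : HasDerivAt F' (f x) x :=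
      (((hs' x).mul (hd x)).add ((hs x).mul (hd' x))).congr_deriv (by simp only [hfdef]; ring)
    have hgc0 : Continuous g := hg.continuous
    have hgc1 : Continuous (deriv g) := hg1.continuous
    have hf : Continuous f := by fun_prop
    have hfc : HasCompactSupport f :=
      ((hgc.mul_left (f := fun _ => (-2 : ℝ))).add
        (hgc.deriv.mul_left (f := fun x => 2 * (a + b - 2 * x)))).add
        (hgc.deriv.deriv.mul_left (f := fun x => (x - a) * (b - x)))
    obtain ⟨M, hM⟩ := hfc.exists_bound_of_continuous hf
    have h1 := hμρ f hf M hM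
    rw [h.integral_deriv_deriv hF hF' hf (by simp) (by simp) hM] at h1
    simp_rw [directedAverage_eq_of_mul h.lt hF hF' hf (by simp only [hF'def]; ring)
      (by simp only [hF'def]; ring)] at h1
    rw [integral_const_mul, integral_const_mul] at h1
    have h2 : ∫ x, (x - a) * (b - x) * g x / ((x - a) * (b - x)) ∂densityMeasure a b p =
        ∫ x, g x ∂densityMeasure a b p := by
      rw [integral_densityMeasure h.integrableOn h.nonneg_left,
        integral_densityMeasure h.integrableOn h.nonneg_left]
      refine setIntegral_congr_fun measurableSet_Ioo fun x hx => ?_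
      have hx' := mul_pos (sub_pos.2 hx.1) (sub_pos.2 hx.2)
      rw [mul_div_cancel_left₀ _ hx'.ne']
    linarith
  · rintro rfl
    refine ext_of_forall_integral_eq_of_IsFiniteMeasure fun f => ?_
    obtain ⟨F, F', hF, hF', hFa, hFb⟩ := exists_hasDerivAt_hasDerivAt h.lt f.continuous
    have hM : ∀ x, |f x| ≤ ‖f‖ := f.norm_coe_le_norm
    rw [hμρ f f.continuous _ hM, h.integral_deriv_deriv hF hF' f.continuous hFa hFb hM,
      integral_densityMeasure h.integrableOn h.nonneg_left,
      integral_densityMeasure h.integrableOn h.nonneg_left]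
    refine setIntegral_congr_fun measurableSet_Ioo fun x hx => ?_
    rw [directedAverage_eq_div h.lt hF hF' f.continuous hFa hFb hx.1.ne' hx.2.ne]

end IsDirectedPair

/-! ### The law of a directed triangular variable -/

/-- The distribution on `[0, 1]` with density `2 * w`. -/
noncomputable def triangularMeasure : Measure ℝ :=
  (volume.restrict (Ioc 0 1)).withDensity fun w => ENNReal.ofReal (2 * w)

theorem triangularMeasure_apply_Ioc {t : ℝ} (h0 : 0 ≤ t) (h1 : t ≤ 1) :
    triangularMeasure (Ioc 0 t) = ENNReal.ofReal (t ^ 2) := by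
  rw [triangularMeasure, withDensity_apply _ measurableSet_Ioc,
    Measure.restrict_restrict measurableSet_Ioc, inter_eq_left.2 (Ioc_subset_Ioc_right h1),
    ← ofReal_integral_eq_lintegral_ofReal, ← intervalIntegral.integral_of_le h0]
  · rw [intervalIntegral.integral_const_mul, integral_id]
    congr 1
    ring
  · exact (Continuous.integrableOn_Icc (by fun_prop)).mono_set Ioc_subset_Icc_self
  · exact (ae_restrict_iff' measurableSet_Ioc).2 (ae_of_all _ fun x hx =>
      mul_nonneg zero_le_two hx.1.le)

theorem triangularMeasure_apply {s : Set ℝ} (hs : MeasurableSet s) :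
    triangularMeasure s = triangularMeasure (s ∩ Ioc 0 1) := by
  rw [triangularMeasure, withDensity_apply _ hs, withDensity_apply _ (hs.inter measurableSet_Ioc),
    Measure.restrict_restrict hs, Measure.restrict_restrict (hs.inter measurableSet_Ioc),
    inter_assoc, inter_self]

instance : IsProbabilityMeasure triangularMeasure where
  measure_univ := by
    rw [triangularMeasure_apply MeasurableSet.univ, univ_inter,
      triangularMeasure_apply_Ioc zero_le_one le_rfl]
    simp

instance : NullSingletonClass triangularMeasure :=
  nullSingletonClass_withDensity _

theorem triangularMeasure_real_Iic (t : ℝ) :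
    triangularMeasure.real (Iic t) = if t ≤ 0 then 0 else if t ≤ 1 then t ^ 2 else 1 := by
  rw [measureReal_def, triangularMeasure_apply measurableSet_Iic, inter_comm, Ioc_inter_Iic]
  split_ifs with h0 h1
  · rw [Ioc_eq_empty (by simp [h0])]; simp
  · push Not at h0
    rw [min_eq_right h1, triangularMeasure_apply_Ioc h0.le h1,
      ENNReal.toReal_ofReal (by positivity)]
  · push Not at h1
    rw [min_eq_left h1.le, triangularMeasure_apply_Ioc zero_le_one le_rfl]; simp

theorem integral_triangularMeasure (g : ℝ → ℝ) :
    ∫ w, g w ∂triangularMeasure = ∫ w in (0 : ℝ)..1, 2 * w * g w := by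
  rw [triangularMeasure, integral_withDensity_eq_integral_toReal_smul (by fun_prop)
    (ae_of_all _ fun _ => ENNReal.ofReal_lt_top), intervalIntegral.integral_of_le zero_le_one]
  refine setIntegral_congr_fun measurableSet_Ioc fun x hx => ?_
  simp only [ENNReal.toReal_ofReal (mul_nonneg zero_le_two hx.1.le), smul_eq_mul]

/-- The law of `x + W (y - x)`, for `W` with density `2 w` on `[0, 1]`, has the directed triangular
distribution function between `x` and `y`. -/
theorem cdf_map_triangularMeasure (x y z : ℝ) :
    cdf (triangularMeasure.map fun w => x + w * (y - x)) z = directedPowerCDF 2 x y z := by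
  have hm : Measurable fun w : ℝ => x + w * (y - x) := by fun_prop
  have := Measure.isProbabilityMeasure_map (μ := triangularMeasure) hm.aemeasurable
  rw [cdf_eq_real, map_measureReal_apply hm measurableSet_Iic, directedPowerCDF]
  rcases lt_trichotomy x y with hxy | rfl | hxy
  · have hd : 0 < y - x := sub_pos.2 hxy
    have hset : (fun w : ℝ => x + w * (y - x)) ⁻¹' Iic z = Iic ((z - x) / (y - x)) := by
      ext w
      simp only [mem_preimage, mem_Iic, le_div_iff₀ hd]
      constructor <;> intro h <;> linarith
    rw [hset, triangularMeasure_real_Iic, max_eq_right hxy.le, min_eq_left hxy.le, if_pos hxy]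
    simp only [div_le_iff₀ hd, zero_mul, one_mul, sub_nonpos, sub_le_sub_iff_right]
    split_ifs with h1 h2 h3 h4 h5
    · linarith
    · rfl
    · rw [le_antisymm h3 h4, div_self hd.ne', one_pow]
    · rfl
    · rfl
    · linarith
  · by_cases hz : x ≤ z <;> simp [hz]
    exact (not_le.1 hz).le
  · have hd : y - x < 0 := sub_neg.2 hxy
    have hset : (fun w : ℝ => x + w * (y - x)) ⁻¹' Iic z = (Iio ((z - x) / (y - x)))ᶜ := by
      ext w
      simp only [mem_preimage, mem_Iic, compl_Iio, mem_Ici, div_le_iff_of_neg hd]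
      constructor <;> intro h <;> linarith
    rw [hset, probReal_compl_eq_one_sub measurableSet_Iio, measureReal_congr Iio_ae_eq_Iic,
      triangularMeasure_real_Iic, max_eq_left hxy.le, min_eq_right hxy.le,
      if_neg hxy.not_gt]
    simp only [div_le_iff_of_neg hd, zero_mul, one_mul, sub_nonneg, sub_le_sub_iff_right]
    split_ifs with h1 h2 h3 h4
    · simp
    · rw [le_antisymm h3 h2, div_self hd.ne]; simp
    · rfl
    · simp
    · linarith

theorem condDistrib_ae_eq_map {Ω : Type*} [MeasurableSpace Ω] {P : Measure Ω}
    [IsProbabilityMeasure P] {X₁ X₂ Z₁ : Ω → ℝ} (hZ : IsDirectedTriangular P X₁ X₂ Z₁) :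
    ∀ᵐ x ∂(P.map fun ω => (X₁ ω, X₂ ω)), condDistrib Z₁ (fun ω => (X₁ ω, X₂ ω)) P x =
      triangularMeasure.map fun w => x.1 + w * (x.2 - x.1) := by
  filter_upwards [hZ] with x hx
  have hm : Measurable fun w : ℝ => x.1 + w * (x.2 - x.1) := by fun_prop
  have := Measure.isProbabilityMeasure_map (μ := triangularMeasure) hm.aemeasurable
  refine Measure.eq_of_cdf _ _ (StieltjesFunction.ext fun z => ?_)
  rw [hx z, cdf_map_triangularMeasure]

theorem integral_cond_Icc {a b : ℝ} (hab : a < b) (g : ℝ → ℝ) :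
    ∫ y, g y ∂(ProbabilityTheory.cond volume (Icc a b)) = (b - a)⁻¹ * ∫ y in a..b, g y := by
  rw [ProbabilityTheory.cond, integral_smul_measure, Real.volume_Icc, ENNReal.toReal_inv,
    ENNReal.toReal_ofReal (sub_pos.2 hab).le, integral_Icc_eq_integral_Ioc,
    intervalIntegral.integral_of_le hab.le, smul_eq_mul]

/-- The law of `Z₁` is obtained from the law of `X₁` by averaging over the uniform variable `X₂`
and over the position of `Z₁` on the segment from `X₁` to `X₂`. -/
theorem integral_map_of_isDirectedTriangular {Ω : Type*} [MeasurableSpace Ω] {P : Measure Ω}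
    [IsProbabilityMeasure P] {X₁ X₂ Z₁ : Ω → ℝ} (hX₁ : AEMeasurable X₁ P)
    (hX₂ : AEMeasurable X₂ P) (hZ₁ : AEMeasurable Z₁ P) (hindep : IndepFun X₁ X₂ P)
    (hZ : IsDirectedTriangular P X₁ X₂ Z₁) {a b : ℝ} (hab : a < b)
    (hunif : pdf.IsUniform X₂ (Icc a b) P) {f : ℝ → ℝ} (hf : Continuous f) {M : ℝ}
    (hM : ∀ x, |f x| ≤ M) :
    ∫ z, f z ∂P.map Z₁ = ∫ x, directedAverage a b f x ∂P.map X₁ := by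
  have hX : AEMeasurable (fun ω => (X₁ ω, X₂ ω)) P := hX₁.prodMk hX₂
  have := Measure.isProbabilityMeasure_map hX
  have := Measure.isProbabilityMeasure_map hX₁
  have := Measure.isProbabilityMeasure_map hX₂
  have hsegment (x : ℝ × ℝ) :
      ∫ z, f z ∂(triangularMeasure.map fun w => x.1 + w * (x.2 - x.1)) =
        ∫ w in (0 : ℝ)..1, 2 * w * f (x.1 + w * (x.2 - x.1)) := by
    rw [integral_map (by fun_prop) hf.aestronglyMeasurable, integral_triangularMeasure]
  have hcont : Continuous fun x : ℝ × ℝ =>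
      ∫ w in (0 : ℝ)..1, 2 * w * f (x.1 + w * (x.2 - x.1)) :=
    intervalIntegral.continuous_parametric_intervalIntegral_of_continuous'
      (by simp only [Function.uncurry_def]; fun_prop) 0 1
  have hbound (x : ℝ × ℝ) : ‖∫ w in (0 : ℝ)..1, 2 * w * f (x.1 + w * (x.2 - x.1))‖ ≤ M := by
    rw [← hsegment]
    have := Measure.isProbabilityMeasure_map (μ := triangularMeasure)
      (f := fun w => x.1 + w * (x.2 - x.1)) (by fun_prop)
    simpa using norm_integral_le_of_norm_le_const (f := f) (C := M) (ae_of_all _ hM)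
      (μ := triangularMeasure.map fun w => x.1 + w * (x.2 - x.1))
  calc ∫ z, f z ∂P.map Z₁
      = ∫ u, f u.2 ∂(P.map fun ω => ((X₁ ω, X₂ ω), Z₁ ω)) := by
        rw [integral_map hZ₁ hf.aestronglyMeasurable,
          integral_map (hX.prodMk hZ₁) (by fun_prop)]
    _ = ∫ x, ∫ z, f z ∂condDistrib Z₁ (fun ω => (X₁ ω, X₂ ω)) P x
          ∂(P.map fun ω => (X₁ ω, X₂ ω)) := by
        rw [← compProd_map_condDistrib hZ₁, Measure.integral_compProd]
        exact Integrable.of_bound (by fun_prop) M (ae_of_all _ fun u => hM u.2)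
    _ = ∫ x : ℝ × ℝ, (∫ w in (0 : ℝ)..1, 2 * w * f (x.1 + w * (x.2 - x.1)))
          ∂(P.map fun ω => (X₁ ω, X₂ ω)) := by
        refine integral_congr_ae ?_
        filter_upwards [condDistrib_ae_eq_map hZ] with x hx
        rw [hx, hsegment]
    _ = ∫ x, directedAverage a b f x ∂P.map X₁ := by
        rw [(indepFun_iff_map_prod_eq_prod_map_map hX₁ hX₂).1 hindep, integral_prod]
        · refine integral_congr_ae (ae_of_all _ fun x => ?_)
          simp only [directedAverage]
          rw [show P.map X₂ = _ from hunif, integral_cond_Icc hab]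
        · exact Integrable.of_bound hcont.aestronglyMeasurable M (ae_of_all _ hbound)

theorem IsDirectedPair.hasLaw_iff {Ω : Type*} [MeasurableSpace Ω] {P : Measure Ω}
    [IsProbabilityMeasure P] {X₁ X₂ Z₁ : Ω → ℝ} (hX₁ : AEMeasurable X₁ P)
    (hX₂ : AEMeasurable X₂ P) (hZ₁ : AEMeasurable Z₁ P) (hindep : IndepFun X₁ X₂ P)
    (hZ : IsDirectedTriangular P X₁ X₂ Z₁) {a b : ℝ} {p q : ℝ → ℝ} (h : IsDirectedPair a b p q)
    (hunif : pdf.IsUniform X₂ (Icc a b) P) :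
    HasLaw Z₁ (densityMeasure a b q) P ↔ HasLaw X₁ (densityMeasure a b p) P := by
  have hiff := h.eq_densityMeasure_iff (μ := P.map X₁) (ρ := P.map Z₁) fun f hf M hM =>
    integral_map_of_isDirectedTriangular hX₁ hX₂ hZ₁ hindep hZ h.lt hunif hf hM
  exact ⟨fun hl => ⟨hX₁, hiff.1 hl.map_eq⟩, fun hl => ⟨hZ₁, hiff.2 hl.map_eq⟩⟩

/-! ### The two families of pairs -/

theorem sub_mul_sub_pos {a b x : ℝ} (hx : x ∈ Ioo a b) : 0 < (x - a) * (b - x) :=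
  mul_pos (sub_pos.2 hx.1) (sub_pos.2 hx.2)

theorem hasDerivAt_sub_mul_sub (a b x : ℝ) :
    HasDerivAt (fun x => (x - a) * (b - x)) (a + b - 2 * x) x :=
  (((hasDerivAt_id x).sub_const a).mul ((hasDerivAt_id x).const_sub b)).congr_deriv
    (by simp only [id]; ring)

theorem isDirectedPair_parabola {a b C : ℝ} (hab : a < b) (hC : 0 ≤ C) :
    IsDirectedPair a b (fun x => C * ((x - a) * (b - x))) (fun x => C * ((x - a) * (b - x))) where
  lt := hab
  nonneg_left x hx := mul_nonneg hC (sub_mul_sub_pos hx).le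
  nonneg_right x hx := mul_nonneg hC (sub_mul_sub_pos hx).le
  integrableOn := (Continuous.integrableOn_Icc (by fun_prop)).mono_set Ioo_subset_Icc_self
  continuousOn := Continuous.continuousOn (by fun_prop)
  apply_left := by simp
  apply_right := by simp
  exists_deriv := by
    refine ⟨fun x => C * (a + b - 2 * x), fun x _ => (hasDerivAt_sub_mul_sub a b x).const_mul C,
      fun x hx => ?_, Continuous.continuousOn (by fun_prop)⟩
    have hs := (sub_mul_sub_pos hx).ne'
    refine ((((hasDerivAt_id x).const_mul 2).const_sub (a + b)).const_mul C).congr_deriv ?_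
    rw [← mul_assoc, mul_div_cancel_right₀ _ hs]
    ring

/-- `1 / √((x - a) (b - x))` is the derivative of `arcsin ((2 x - a - b) / (b - a))`. -/
theorem integrableOn_inv_sqrt {a b : ℝ} (hab : a < b) :
    IntegrableOn (fun x => (√((x - a) * (b - x)))⁻¹) (Ioo a b) := by
  have hba : 0 < b - a := sub_pos.2 hab
  refine (intervalIntegral.integrableOn_deriv_of_nonneg
    (g := fun x => Real.arcsin ((2 * x - a - b) / (b - a)))
    (Continuous.continuousOn (by fun_prop)) (fun x hx => ?_) (fun x hx => by positivity)).mono_set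
    Ioo_subset_Ioc_self
  have hs := sub_mul_sub_pos hx
  have h1 : (2 * x - a - b) / (b - a) < 1 := by
    rw [div_lt_one hba]; linarith [hx.2]
  have h2 : -1 < (2 * x - a - b) / (b - a) := by
    rw [lt_div_iff₀ hba]; linarith [hx.1]
  have hlin : HasDerivAt (fun x => (2 * x - a - b) / (b - a)) (2 / (b - a)) x :=
    (((((hasDerivAt_id x).const_mul 2).sub_const a).sub_const b).div_const (b - a)).congr_deriv
      (by simp)
  refine ((Real.hasDerivAt_arcsin h2.ne' h1.ne).comp x hlin).congr_deriv ?_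
  have h3 : 1 - ((2 * x - a - b) / (b - a)) ^ 2 = (2 / (b - a)) ^ 2 * ((x - a) * (b - x)) := by
    field_simp; ring
  rw [h3, Real.sqrt_mul (sq_nonneg _), Real.sqrt_sq (by positivity)]
  have := (Real.sqrt_pos.2 hs).ne'
  field_simp

/-- For `s = (x - a) (b - x)` one has `2 s s'' - s' ^ 2 = -(b - a) ^ 2`, hence
`(√s)'' = -(b - a) ^ 2 / (4 s √s)`. -/
theorem isDirectedPair_sqrt {a b C : ℝ} (hab : a < b) (hC : 0 ≤ C) :
    IsDirectedPair a b (fun x => C * (b - a) ^ 2 / 8 * (√((x - a) * (b - x)))⁻¹)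
      (fun x => C * √((x - a) * (b - x))) where
  lt := hab
  nonneg_left x hx := by positivity
  nonneg_right x hx := by positivity
  integrableOn := (integrableOn_inv_sqrt hab).const_mul _
  continuousOn := Continuous.continuousOn (by fun_prop)
  apply_left := by simp
  apply_right := by simp
  exists_deriv := by
    refine ⟨fun x => C * ((a + b - 2 * x) / (2 * √((x - a) * (b - x)))), fun x hx => ?_,
      fun x hx => ?_, ?_⟩
    · exact ((hasDerivAt_sub_mul_sub a b x).sqrt (sub_mul_sub_pos hx).ne').const_mul C
    · have hs := sub_mul_sub_pos hx
      have hd := (hasDerivAt_sub_mul_sub a b x).sqrt hs.ne'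
      have hr := Real.sqrt_pos.2 hs
      have hsq : √((x - a) * (b - x)) ^ 2 = (x - a) * (b - x) := Real.sq_sqrt hs.le
      refine (((((hasDerivAt_id x).const_mul 2).const_sub (a + b)).div (hd.const_mul 2)
        (by positivity)).const_mul C).congr_deriv ?_
      generalize √((x - a) * (b - x)) = t at hsq hr
      rw [← hsq]
      simp only [id]
      field_simp
      rw [hsq]
      ring
    · have : (fun x => (x - a) * (b - x) * (C * ((a + b - 2 * x) / (2 * √((x - a) * (b - x)))))) =
          fun x => C * (a + b - 2 * x) / 2 * √((x - a) * (b - x)) := by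
        ext x
        have h := Real.div_sqrt (x := (x - a) * (b - x))
        calc (x - a) * (b - x) * (C * ((a + b - 2 * x) / (2 * √((x - a) * (b - x)))))
            = C * (a + b - 2 * x) / 2 * ((x - a) * (b - x) / √((x - a) * (b - x))) := by ring
          _ = _ := by rw [h]
      rw [this]
      exact Continuous.continuousOn (by fun_prop)

/-! ### The named distributions as interval densities -/

theorem arcsineMeasure_eq : arcsineMeasure =
    densityMeasure (-1) 1 fun x =>
      2 / Real.pi * (1 - -1) ^ 2 / 8 * (√((x - -1) * (1 - x)))⁻¹ := by
  refine densityMeasure_congr fun x _ => ?_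
  rw [show (x - -1) * (1 - x) = 1 - x ^ 2 by ring, one_div, mul_inv]
  ring

theorem semicircleMeasure_eq : semicircleMeasure =
    densityMeasure (-1) 1 fun x => 2 / Real.pi * √((x - -1) * (1 - x)) := by
  rw [semicircleMeasure, ← Measure.restrict_congr_set Ioo_ae_eq_Icc]
  refine densityMeasure_congr fun x _ => ?_
  rw [show (x - -1) * (1 - x) = 1 - x ^ 2 by ring]

theorem powerSemicircleMeasure_eq : powerSemicircleMeasure =
    densityMeasure (-1) 1 fun x => 3 / 4 * ((x - -1) * (1 - x)) := by
  rw [powerSemicircleMeasure, ← Measure.restrict_congr_set Ioo_ae_eq_Icc]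
  refine densityMeasure_congr fun x _ => ?_
  ring

theorem betaMeasure_eq_densityMeasure (α β : ℝ) : betaMeasure α β =
    densityMeasure 0 1 fun x => 1 / beta α β * x ^ (α - 1) * (1 - x) ^ (β - 1) := by
  rw [densityMeasure, ← withDensity_indicator measurableSet_Ioo, betaMeasure]
  congr 1
  ext x
  by_cases hx : x ∈ Ioo (0 : ℝ) 1
  · rw [indicator_of_mem hx, betaPDF_of_pos_lt_one hx.1 hx.2]
  · rw [indicator_of_notMem hx, betaPDF_eq, if_neg (by simpa using hx), ENNReal.ofReal_zero]

theorem betaMeasure_one_one : betaMeasure 1 1 = ProbabilityTheory.cond volume (Icc 0 1) := by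
  rw [betaMeasure_eq_densityMeasure, ProbabilityTheory.cond, Real.volume_Icc,
    ← Measure.restrict_congr_set Ioo_ae_eq_Icc, densityMeasure]
  simp [beta, one_add_one_eq_two]

theorem betaMeasure_half_half : betaMeasure (1 / 2) (1 / 2) =
    densityMeasure 0 1 fun x =>
      8 / Real.pi * (1 - 0) ^ 2 / 8 * (√((x - 0) * (1 - x)))⁻¹ := by
  rw [betaMeasure_eq_densityMeasure]
  refine densityMeasure_congr fun x hx => ?_
  have hb : beta (1 / 2) (1 / 2) = Real.pi := by
    rw [beta, Real.Gamma_one_half_eq, add_halves, Real.Gamma_one, div_one,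
      Real.mul_self_sqrt Real.pi_pos.le]
  rw [hb, sub_zero x, Real.sqrt_mul hx.1.le, mul_inv, Real.sqrt_eq_rpow, Real.sqrt_eq_rpow,
    ← Real.rpow_neg hx.1.le, ← Real.rpow_neg (sub_pos.2 hx.2).le]
  norm_num
  ring

theorem betaMeasure_threeHalves_threeHalves : betaMeasure (3 / 2) (3 / 2) =
    densityMeasure 0 1 fun x => 8 / Real.pi * √((x - 0) * (1 - x)) := by
  rw [betaMeasure_eq_densityMeasure]
  refine densityMeasure_congr fun x hx => ?_
  have hb : beta (3 / 2) (3 / 2) = Real.pi / 8 := by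
    have h3 : Real.Gamma (3 / 2 + 3 / 2) = 2 := by
      rw [show (3 / 2 + 3 / 2 : ℝ) = (2 : ℕ) + 1 by norm_num, Real.Gamma_nat_eq_factorial]
      norm_num
    have h32 : Real.Gamma (3 / 2) = 1 / 2 * √Real.pi := by
      rw [show (3 / 2 : ℝ) = 1 / 2 + 1 by norm_num, Real.Gamma_add_one (by norm_num),
        Real.Gamma_one_half_eq]
    rw [beta, h3, h32, mul_mul_mul_comm, Real.mul_self_sqrt Real.pi_pos.le]
    ring
  rw [hb, sub_zero x, Real.sqrt_mul hx.1.le, Real.sqrt_eq_rpow, Real.sqrt_eq_rpow]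
  norm_num
  ring

theorem betaMeasure_two_two : betaMeasure 2 2 =
    densityMeasure 0 1 fun x => 6 * ((x - 0) * (1 - x)) := by
  rw [betaMeasure_eq_densityMeasure]
  refine densityMeasure_congr fun x hx => ?_
  have hb : beta 2 2 = 1 / 6 := by
    have h4 : Real.Gamma (2 + 2) = 6 := by
      rw [show (2 + 2 : ℝ) = (3 : ℕ) + 1 by norm_num, Real.Gamma_nat_eq_factorial]
      norm_num [Nat.factorial]
    rw [beta, h4, Real.Gamma_two]
    norm_num
  rw [hb]
  norm_num
  ring

theorem theorem3p2 {Ω : Type*} [MeasurableSpace Ω] (P : Measure Ω) [IsProbabilityMeasure P]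
    (X₁ X₂ Z₁ : Ω → ℝ) (hX₁ : AEMeasurable X₁ P) (hX₂ : AEMeasurable X₂ P)
    (hZ₁ : AEMeasurable Z₁ P) (hindep : IndepFun X₁ X₂ P)
    (hZ : IsDirectedTriangular P X₁ X₂ Z₁) :
    (pdf.IsUniform X₂ (Set.Icc (-1) 1) P →
      (HasLaw Z₁ semicircleMeasure P ↔ HasLaw X₁ arcsineMeasure P)) ∧
    (pdf.IsUniform X₂ (Set.Icc (-1) 1) P →
      (HasLaw Z₁ powerSemicircleMeasure P ↔ HasLaw X₁ powerSemicircleMeasure P)) ∧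
    (HasLaw X₂ (betaMeasure 1 1) P →
      (HasLaw Z₁ (betaMeasure (3 / 2) (3 / 2)) P ↔ HasLaw X₁ (betaMeasure (1 / 2) (1 / 2)) P)) ∧
    (pdf.IsUniform X₂ (Set.Icc 0 1) P →
      (HasLaw Z₁ (betaMeasure 2 2) P ↔ HasLaw X₁ (betaMeasure 2 2) P)) := by
  have hiff {a b : ℝ} {p q : ℝ → ℝ} (h : IsDirectedPair a b p q)
      (hunif : pdf.IsUniform X₂ (Icc a b) P) :=
    h.hasLaw_iff hX₁ hX₂ hZ₁ hindep hZ hunif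
  refine ⟨fun hunif => ?_, fun hunif => ?_, fun hbeta => ?_, fun hunif => ?_⟩
  · rw [semicircleMeasure_eq, arcsineMeasure_eq]
    exact hiff (isDirectedPair_sqrt (by norm_num) (by positivity)) hunif
  · rw [powerSemicircleMeasure_eq]
    exact hiff (isDirectedPair_parabola (by norm_num) (by norm_num)) hunif
  · rw [betaMeasure_threeHalves_threeHalves, betaMeasure_half_half]
    exact hiff (isDirectedPair_sqrt zero_lt_one (by positivity))
      (hbeta.map_eq.trans betaMeasure_one_one)
  · rw [betaMeasure_two_two]
    exact hiff (isDirectedPair_parabola zero_lt_one (by norm_num)) hunif
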